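/- For real $a,b$, real $c>0$ and $-1<z<1$ let ${}_2F_1(a,b;c;z)=\sum_{n\ge 0}\frac{(a)_n(b)_n}{(c)_n}\frac{z^n}{n!}$, where $(a)_n=a(a+1)\cdots(a+n-1)$; for real $z\le -1$ let ${}_2F_1(a,b;c;z)$ be the value at $z$ of the analytic continuation of this function along the real axis to $(-\infty,1)$; and for $z=1$ let it be the sum of the series when that converges. **Theorem 1.** Let $c>0$ and $\eta>0$, and let $x\in[-1,1]$ if $\eta\ge 1$, and $x\in(-\eta,\eta^2]$ if $0<\eta<1$. Put $X=\frac{x+\eta}{1+\eta}$. Suppose that the series $$S(\eta,c;x)=\sum_{k\ge 0}\Bigl(\frac{1-x}{1+\eta}\Bigr)^k\,{}_2F_1\bigl(\tfrac k2+\tfrac12,\tfrac k2+1;c;x\bigr)$$ is absolutely convergent. (For $x=1$ the terms with $k\ge1$ are taken to be $0$, the term with $k=0$ is ${}_2F_1(\tfrac12,1;c;1)$, and absolute convergence means that the series defining this term converges.) If $X\neq0$, then ${}_2F_1\bigl(\tfrac12,1;c;\tfrac{x}{X^2}\bigr)$ is defined, that is, $x/X^2<1$ and the analytic continuation exists, or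 $x/X^2=1$ and the series converges there, and $$S(\eta,c;x)=\frac1X\,{}_2F_1\Bigl(\tfrac12,1;c;\frac{x}{X^2}\Bigr).$$ In the only remaining case $\eta=1$, $x=-1$, where $X=0$, the identity holds with the right-hand side replaced by its limit as $x\downarrow-1$. -/

import Mathlib

open Filter Topology

/-- `F` is a real-analytic continuation to `(-∞, 1)` of the Gauss series
`∑ (a)_n (b)_n / (c)_n * z ^ n / n!`, which converges for `|z| < 1`. On `(-∞, 1)` this is the
principal branch of the Gauss hypergeometric function. -/
def IsGaussContinuation (a b c : ℝ) (F : ℝ → ℝ) : Prop :=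
  AnalyticOnNhd ℝ F (Set.Iio 1) ∧ ∀ z : ℝ, |z| < 1 → F z = ₂F₁ a b c z

/-- The continuation is unique on `(-∞, 1)`. -/
theorem IsGaussContinuation.eqOn {a b c : ℝ} {F G : ℝ → ℝ}
    (hF : IsGaussContinuation a b c F) (hG : IsGaussContinuation a b c G) :
    Set.EqOn F G (Set.Iio 1) := by
  refine hF.1.eqOn_of_preconnected_of_eventuallyEq hG.1 isPreconnected_Iio
    (z₀ := 0) (by simp) ?_
  have h : Set.Ioo (-1 : ℝ) 1 ∈ 𝓝 (0 : ℝ) := Ioo_mem_nhds (by norm_num) (by norm_num)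
  filter_upwards [h] with z hz
  rw [hF.2 z (abs_lt.2 hz), hG.2 z (abs_lt.2 hz)]

/-- The Gauss hypergeometric function at a real argument `z ≤ 1`: the sum of the Gauss series for
`-1 < z ≤ 1` (at `z = 1` this is meaningful only if the series converges), and the value of the
analytic continuation of the series for `z ≤ -1`. -/
noncomputable def gaussF (a b c z : ℝ) : ℝ :=
  if -1 < z then ₂F₁ a b c z else Classical.epsilon (IsGaussContinuation a b c) z

/-- The symbol `gaussF a b c z` is meaningful (not a junk value): either `z < 1` and the analytic
continuation exists, or `z = 1` and the Gauss series converges at `1`. -/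
def GaussDefined (a b c z : ℝ) : Prop :=
  (z < 1 ∧ ∃ F : ℝ → ℝ, IsGaussContinuation a b c F) ∨
    (z = 1 ∧ Summable (ordinaryHypergeometricCoefficient a b c))

/-- The `k`-th term of the series `S(η, c; x)`. For `x = 1` the terms with `k ≥ 1` vanish. -/
noncomputable def hypSumTerm (η c x : ℝ) (k : ℕ) : ℝ :=
  ((1 - x) / (1 + η)) ^ k * gaussF ((k : ℝ) / 2 + 1 / 2) ((k : ℝ) / 2 + 1) c x

/-- `S(η, c; x)` converges absolutely. If `x = 1`, only the term `k = 0` has nonzero weight, and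
the requirement includes that the Gauss series which defines this term converges. -/
def HypSumConvergesAbsolutely (η c x : ℝ) : Prop :=
  (x = 1 → Summable (ordinaryHypergeometricCoefficient (1 / 2 : ℝ) 1 c)) ∧
    Summable fun k : ℕ => |hypSumTerm η c x k|

/-- `S(η, c; x)`. -/
noncomputable def hypSum (η c x : ℝ) : ℝ := ∑' k : ℕ, hypSumTerm η c x k

/-- `X = (x + η) / (1 + η)`. -/
noncomputable def hypX (η x : ℝ) : ℝ := (x + η) / (1 + η)

/-- The closed form, for `X ≠ 0`. -/
noncomputable def hypClosedForm (η c x : ℝ) : ℝ :=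
  1 / hypX η x * gaussF (1 / 2) 1 c (x / hypX η x ^ 2)

/-! Let F = ₂F₁(1/2, 1; c; ·), continued to (-∞, 1) by Pfaff's transformation, and G(y) = (1-y)⁻¹
F(x/(1-y)²) (`scaledGauss`). Each y-derivative raises one parameter by 1, so the k-th Taylor
coefficient of G at 0 is ₂F₁(k/2+1/2, k/2+1; c; x) (`iteratedDeriv_scaledGauss`). Hence, for x < 1,
S is the Taylor series of G at y₀ = (1-x)/(1+η) = 1-X, and the closed form is G(y₀).

The range of x gives X ≥ 0 and x ≤ X², so G is analytic for y < y₀; absolute convergence and the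
identity theorem then make S the left limit of G at y₀ (`tendsto_scaledGauss`). If x < X², G is
continuous at y₀. If x = X² > 0, nonnegative coefficients force the Gauss series to converge at 1.
If X = 0, a rescaling turns the limit in y into the limit x ↓ -1. -/

/-! ### Binomial transforms. -/

theorem sum_choose_mul_succ (n : ℕ) (w : ℕ → ℝ) :
    ∑ m ∈ Finset.range (n + 2), ((n + 1).choose m : ℝ) * w m =
      ∑ m ∈ Finset.range (n + 1), (n.choose m : ℝ) * (w m + w (m + 1)) := by
  have h := Finset.sum_choose_succ_mul (fun i _ => w i) n
  simp only [h, mul_add, Finset.sum_add_distrib]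

theorem ascPochhammer_eval_succ_left (a : ℝ) (n : ℕ) :
    (ascPochhammer ℝ (n + 1)).eval a = a * (ascPochhammer ℝ n).eval (a + 1) := by
  simp [ascPochhammer_succ_left, Polynomial.eval_comp]

/-- The Chu-Vandermonde identity in the form of a binomial transform. -/
theorem sum_choose_mul_ascPochhammer_div (n : ℕ) : ∀ a c : ℝ, 0 < c →
    ∑ m ∈ Finset.range (n + 1), (n.choose m : ℝ) *
      ((-1) ^ m * ((ascPochhammer ℝ m).eval (c - a) / (ascPochhammer ℝ m).eval c)) =
      (ascPochhammer ℝ n).eval a / (ascPochhammer ℝ n).eval c := by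
  induction n with
  | zero => simp
  | succ n ih =>
    intro a c hc
    -- By Pascal's rule consecutive terms are added; each such sum is a/c times the term for (a+1,
    -- c+1), with c-a unchanged.
    rw [sum_choose_mul_succ, ascPochhammer_eval_succ_left, ascPochhammer_eval_succ_left,
      mul_div_mul_comm, ← ih (a + 1) (c + 1) (by linarith), Finset.mul_sum]
    refine Finset.sum_congr rfl fun m _ => ?_
    have h1 : (ascPochhammer ℝ m).eval c ≠ 0 := (ascPochhammer_pos m c hc).ne'
    have h2 : (ascPochhammer ℝ m).eval (c + 1) ≠ 0 :=
      (ascPochhammer_pos m _ (by linarith)).ne'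
    have h3 : c * (ascPochhammer ℝ m).eval (c + 1) = (ascPochhammer ℝ m).eval c * (c + m) := by
      rw [← ascPochhammer_eval_succ_left, ascPochhammer_succ_eval]
    have h4 : c + m ≠ 0 := by positivity
    rw [ascPochhammer_succ_eval, ascPochhammer_succ_eval, show c + 1 - (a + 1) = c - a by ring,
      show (ascPochhammer ℝ m).eval (c + 1) = (ascPochhammer ℝ m).eval c * (c + m) / c by
        rw [← h3]; field_simp]
    field_simp
    ring

theorem hasSum_choose_mul_pow (k : ℕ) {r : ℝ} (hr : |r| < 1) :
    HasSum (fun n : ℕ => (n.choose k : ℝ) * r ^ n) (r ^ k / (1 - r) ^ (k + 1)) := by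
  have h := (hasSum_choose_mul_geometric_of_norm_lt_one k
    (by simpa using hr : ‖r‖ < 1)).mul_left (r ^ k)
  rw [← hasSum_nat_add_iff' k]
  have h0 : ∑ i ∈ Finset.range k, (i.choose k : ℝ) * r ^ i = 0 :=
    Finset.sum_eq_zero fun i hi => by
      rw [Nat.choose_eq_zero_of_lt (Finset.mem_range.1 hi)]; simp
  rw [h0, sub_zero]
  convert! h using 1
  · ext n; ring
  · ring

/-- Euler's series transformation for a bounded sequence. -/
theorem tsum_binomialTransform {v : ℕ → ℝ} {B : ℝ} (hv : ∀ m, |v m| ≤ B) {z : ℝ}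
    (hz : |z| < 1 / 2) :
    ∑' n : ℕ, (∑ m ∈ Finset.range (n + 1), (n.choose m : ℝ) * ((-1) ^ m * v m)) * z ^ n =
      (1 - z)⁻¹ * ∑' m, v m * (z / (z - 1)) ^ m := by
  have hB : 0 ≤ B := (abs_nonneg _).trans (hv 0)
  have hz1 : |z| < 1 := by linarith
  have hz' : 1 - z ≠ 0 := by have := abs_lt.1 hz1; linarith
  have hz'' : z - 1 ≠ 0 := by have := abs_lt.1 hz1; linarith
  let f : ℕ → ℕ → ℝ := fun n m => (n.choose m : ℝ) * ((-1) ^ m * v m) * z ^ n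
  have hf0 : ∀ n, ∀ m ∉ Finset.range (n + 1), f n m = 0 := fun n m hm => by
    simp only [Finset.mem_range, not_lt] at hm
    simp [f, Nat.choose_eq_zero_of_lt (show n < m by omega)]
  have hsum : Summable (Function.uncurry f) := by
    rw [← summable_norm_iff, summable_prod_of_nonneg (fun _ => norm_nonneg _)]
    constructor
    · intro n
      exact summable_of_ne_finset_zero (s := Finset.range (n + 1))
        fun m hm => by simp [Function.uncurry, hf0 n m hm]
    -- Row n of the binomials sums to 2ⁿ, hence the restriction |z| < 1/2.
    · have hg : Summable fun n : ℕ => B * (2 * |z|) ^ n :=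
        (summable_geometric_of_lt_one (by positivity) (by linarith)).mul_left B
      refine Summable.of_nonneg_of_le (fun n => tsum_nonneg fun _ => norm_nonneg _)
        (fun n => ?_) hg
      rw [tsum_eq_sum (s := Finset.range (n + 1))
        fun m hm => by simp [Function.uncurry, hf0 n m hm]]
      calc ∑ m ∈ Finset.range (n + 1), ‖Function.uncurry f (n, m)‖
          ≤ ∑ m ∈ Finset.range (n + 1), (n.choose m : ℝ) * (B * |z| ^ n) := by
            refine Finset.sum_le_sum fun m _ => ?_
            simp only [Function.uncurry, f, norm_mul, norm_pow, norm_neg, norm_one, one_pow,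
              one_mul, Real.norm_eq_abs, Nat.abs_cast, mul_assoc]
            gcongr
            exact hv m
        _ = B * (2 * |z|) ^ n := by
            rw [← Finset.sum_mul, ← Nat.cast_sum, Nat.sum_range_choose, mul_pow]
            push_cast; ring
  have h1 : ∀ n, ∑' m, f n m =
      (∑ m ∈ Finset.range (n + 1), (n.choose m : ℝ) * ((-1) ^ m * v m)) * z ^ n := fun n => by
    rw [tsum_eq_sum (hf0 n), Finset.sum_mul]
  have h2 : ∀ m, ∑' n, f n m = (1 - z)⁻¹ * (v m * (z / (z - 1)) ^ m) := fun m => by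
    have h := (hasSum_choose_mul_pow m hz1).mul_left ((-1) ^ m * v m)
    have e : (fun n => f n m) = fun n : ℕ => (-1) ^ m * v m * ((n.choose m : ℝ) * z ^ n) := by
      ext n; simp only [f]; ring
    rw [e, h.tsum_eq, show z - 1 = -1 * (1 - z) by ring, div_pow, mul_pow]
    have : ((-1 : ℝ) ^ m) * (-1) ^ m = 1 := by rw [← mul_pow]; simp
    field_simp
    rw [pow_two, this]
    ring
  simp_rw [← h1]
  rw [← Summable.tsum_comm (f := f) hsum, ← tsum_mul_left]
  exact tsum_congr h2

/-! ### Analytic continuation to (-∞, 1). -/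

theorem hasFPowerSeriesOnBall_tsum {u : ℕ → ℝ} {r : ENNReal} (hr : 0 < r)
    (h : r ≤ (FormalMultilinearSeries.ofScalars ℝ u).radius) :
    HasFPowerSeriesOnBall (fun z : ℝ => ∑' n, u n * z ^ n)
      (FormalMultilinearSeries.ofScalars ℝ u) 0 r := by
  have h1 := ((FormalMultilinearSeries.ofScalars ℝ u).hasFPowerSeriesOnBall
    (hr.trans_le h)).mono hr h
  refine h1.congr fun z _ => ?_
  exact tsum_congr fun n => by simp [mul_comm]

theorem one_le_radius_of_bounded {v : ℕ → ℝ} {B : ℝ} (hv : ∀ m, |v m| ≤ B) :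
    1 ≤ (FormalMultilinearSeries.ofScalars ℝ v).radius := by
  have := (FormalMultilinearSeries.ofScalars ℝ v).le_radius_of_bound (r := 1) B
    fun n => by simpa [FormalMultilinearSeries.ofScalars_norm] using hv n
  simpa using this

theorem mem_eball_zero_one {z : ℝ} (hz : |z| < 1) : z ∈ Metric.eball (0 : ℝ) 1 := by
  rw [← ENNReal.ofReal_one, Metric.eball_ofReal]; simpa using hz

/-- Only the first factor (c-a)/c can exceed 1 in modulus; the later ones (c-a+m)/(c+m), m ≥ 1,
cannot, because a ≤ 1. -/
theorem abs_ascPochhammer_div_le {a c : ℝ} (ha : 0 ≤ a) (ha' : a ≤ 1) (hc : 0 < c) (m : ℕ) :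
    |(ascPochhammer ℝ m).eval (c - a) / (ascPochhammer ℝ m).eval c| ≤ 1 + a / c := by
  have key : ∀ m : ℕ, |(ascPochhammer ℝ (m + 1)).eval (c - a) /
      (ascPochhammer ℝ (m + 1)).eval c| ≤ 1 + a / c := by
    intro m
    induction m with
    | zero =>
      simp only [zero_add, ascPochhammer_one, Polynomial.eval_X]
      rw [abs_div, abs_of_pos hc, div_le_iff₀ hc, add_mul, div_mul_cancel₀ _ hc.ne', abs_le]
      constructor <;> linarith
    | succ m ih =>
      rw [ascPochhammer_succ_eval, ascPochhammer_succ_eval (k := c), mul_div_mul_comm, abs_mul]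
      refine (mul_le_of_le_one_right (abs_nonneg _) ?_).trans ih
      have : 0 < c + ((m + 1 : ℕ) : ℝ) := by positivity
      rw [abs_div, abs_of_pos this, div_le_one this, abs_le]
      push_cast at *
      have : (0 : ℝ) ≤ m := m.cast_nonneg
      constructor <;> linarith
  cases m with
  | zero => simp; positivity
  | succ m => exact key m

theorem hasFPowerSeriesOnBall_gauss {a b c : ℝ} (ha : 0 < a) (hb : 0 < b) (hc : 0 < c) :
    HasFPowerSeriesOnBall (₂F₁ a b c : ℝ → ℝ)
      (FormalMultilinearSeries.ofScalars ℝ (ordinaryHypergeometricCoefficient a b c)) 0 1 := by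
  have h := ordinaryHypergeometricSeries_radius_eq_one ℝ a b c fun kn => by
    have : (0 : ℝ) ≤ kn := kn.cast_nonneg
    refine ⟨?_, ?_, ?_⟩ <;> intro h <;> linarith
  have h1 := (ordinaryHypergeometricSeries ℝ a b c).hasFPowerSeriesOnBall (by rw [h]; simp)
  rw [h] at h1
  exact h1

theorem gauss_eq_tsum (a b c z : ℝ) :
    ₂F₁ a b c z = ∑' n, ordinaryHypergeometricCoefficient a b c n * z ^ n := by
  rw [ordinaryHypergeometric_eq_tsum]; rfl

theorem gaussCoefficient_one (a c : ℝ) (n : ℕ) :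
    ordinaryHypergeometricCoefficient a 1 c n =
      (ascPochhammer ℝ n).eval a / (ascPochhammer ℝ n).eval c := by
  have : (n.factorial : ℝ) ≠ 0 := by positivity
  simp only [ordinaryHypergeometricCoefficient, ascPochhammer_eval_one]
  field_simp

/-- Pfaff's transformation provides the continuation of `₂F₁ a 1 c` to `(-∞, 1)`. -/
theorem exists_isGaussContinuation_one {a c : ℝ} (ha : 0 < a) (ha' : a ≤ 1) (hc : 0 < c) :
    ∃ F, IsGaussContinuation a 1 c F := by
  set v : ℕ → ℝ := fun m => (ascPochhammer ℝ m).eval (c - a) / (ascPochhammer ℝ m).eval c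
  have hv : ∀ m, |v m| ≤ 1 + a / c := abs_ascPochhammer_div_le ha.le ha' hc
  let V : ℝ → ℝ := fun w => ∑' m, v m * w ^ m
  let P : ℝ → ℝ := fun z => (1 - z)⁻¹ * V (z / (z - 1))
  have hV : AnalyticOnNhd ℝ V (Metric.eball 0 1) :=
    (hasFPowerSeriesOnBall_tsum (by simp) (one_le_radius_of_bounded hv)).analyticOnNhd
  have hG : AnalyticOnNhd ℝ (₂F₁ a 1 c : ℝ → ℝ) (Metric.eball 0 1) :=
    (hasFPowerSeriesOnBall_gauss ha one_pos hc).analyticOnNhd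
  -- For z < 1, |z/(z-1)| < 1 exactly when z < 1/2; the Gauss series covers the rest of (-∞, 1).
  have hP : AnalyticOnNhd ℝ P (Set.Iio (1 / 2)) := by
    intro z hz
    have hz : z < 1 / 2 := hz
    have h1 : (1 : ℝ) - z ≠ 0 := by linarith
    have h2 : z - 1 ≠ 0 := by linarith
    have h3 : z / (z - 1) ∈ Metric.eball (0 : ℝ) 1 := by
      apply mem_eball_zero_one
      rw [abs_div, abs_of_neg (by linarith : z - 1 < 0), div_lt_one (by linarith), abs_lt]
      constructor <;> linarith
    have h4 : AnalyticAt ℝ (fun z : ℝ => z / (z - 1)) z := by fun_prop (disch := assumption)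
    have h5 : AnalyticAt ℝ (fun z : ℝ => (1 - z)⁻¹) z := by fun_prop (disch := assumption)
    exact h5.mul (AnalyticAt.fun_comp_of_eq (hV _ h3) h4 rfl)
  have hEq : Set.EqOn P (₂F₁ a 1 c : ℝ → ℝ) (Set.Ioo (-1) (1 / 2)) := by
    refine (hP.mono Set.Ioo_subset_Iio_self).eqOn_of_preconnected_of_eventuallyEq
      (hG.mono fun z hz => mem_eball_zero_one ?_) isPreconnected_Ioo (z₀ := 0) (by norm_num) ?_
    · rw [abs_lt]; constructor <;> linarith [hz.1, hz.2]
    · filter_upwards [Ioo_mem_nhds (show (-(1 / 2) : ℝ) < 0 by norm_num)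
        (show (0 : ℝ) < 1 / 2 by norm_num)] with z hz
      have hz : |z| < 1 / 2 := abs_lt.2 hz
      rw [gauss_eq_tsum]
      refine (tsum_binomialTransform hv hz).symm.trans (tsum_congr fun n => ?_)
      rw [gaussCoefficient_one, sum_choose_mul_ascPochhammer_div n a c hc]
  refine ⟨fun z => if z < 1 / 2 then P z else ₂F₁ a 1 c z, ?_, ?_⟩
  · intro z hz
    have hz : z < 1 := hz
    by_cases h : z < 1 / 2
    · refine (hP z h).congr ?_
      filter_upwards [Iio_mem_nhds h] with w hw
      exact (if_pos hw).symm
    · refine (hG z (mem_eball_zero_one ?_)).congr ?_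
      · rw [abs_lt]; constructor <;> linarith
      · filter_upwards [Ioi_mem_nhds (show -1 < z by linarith)] with w hw
        split_ifs with hw'
        · exact (hEq ⟨hw, hw'⟩).symm
        · rfl
  · intro z hz
    have := abs_lt.1 hz
    dsimp only
    split_ifs with h
    · exact hEq ⟨this.1, h⟩
    · rfl

/-! ### Raising parameters by differentiation. -/

theorem hasSum_nat_mul_deriv {u : ℕ → ℝ} {f : ℝ → ℝ} {r : ENNReal}
    (h : HasFPowerSeriesOnBall f (FormalMultilinearSeries.ofScalars ℝ u) 0 r) {z : ℝ}
    (hz : z ∈ Metric.eball (0 : ℝ) r) :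
    HasSum (fun n : ℕ => (n : ℝ) * u n * z ^ n) (z * deriv f z) := by
  have h1 := (h.fderiv.hasSum hz).mapL (ContinuousLinearMap.apply ℝ ℝ z)
  rw [← hasSum_nat_add_iff' 1]
  convert! h1 using 1
  · ext n
    simp only [ContinuousLinearMap.apply_apply,
      FormalMultilinearSeries.derivSeries_apply_diag,
      FormalMultilinearSeries.ofScalars_apply_eq]
    simp [mul_assoc]
  · simp

/-- Raising a parameter of the Gauss function by one. -/
theorem IsGaussContinuation.raise {a b c : ℝ} (ha : 0 < a) (hb : 0 < b) (hc : 0 < c)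
    {F : ℝ → ℝ} (hF : IsGaussContinuation a b c F) :
    IsGaussContinuation b (a + 1) c (fun z => F z + z / a * deriv F z) := by
  refine ⟨fun z hz => ?_, fun z hz => ?_⟩
  · have h1 := hF.1 z hz
    have h2 := h1.deriv
    have h3 : AnalyticAt ℝ (fun z : ℝ => z / a) z := by
      have := ha.ne'
      fun_prop (disch := assumption)
    exact h1.add (h3.mul h2)
  · have hps := hasFPowerSeriesOnBall_gauss ha hb hc
    have hd : deriv F z = deriv (₂F₁ a b c : ℝ → ℝ) z := by
      refine Filter.EventuallyEq.deriv_eq ?_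
      have hz' := abs_lt.1 hz
      filter_upwards [Ioo_mem_nhds hz'.1 hz'.2] with w hw
      exact hF.2 w (abs_lt.2 hw)
    have h1 := (hasSum_nat_mul_deriv hps (mem_eball_zero_one hz)).mul_left a⁻¹
    have h2 := hps.hasSum (mem_eball_zero_one hz)
    have h3 := h2.add h1
    dsimp only
    rw [hF.2 z hz, hd, gauss_eq_tsum b]
    rw [zero_add] at h3
    have h4 := h3.tsum_eq
    rw [show z / a * deriv (₂F₁ a b c : ℝ → ℝ) z =
      a⁻¹ * (z * deriv (₂F₁ a b c : ℝ → ℝ) z) by ring, ← h4]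
    refine tsum_congr fun n => ?_
    rw [FormalMultilinearSeries.ofScalars_apply_eq]
    -- The operator 1 + (z/a) d/dz multiplies the n-th coefficient by (a+n)/a, which turns (a)_n
    -- into (a+1)_n.
    have h5 : (ascPochhammer ℝ n).eval (a + 1) = (ascPochhammer ℝ n).eval a * (a + n) / a := by
      rw [← ascPochhammer_succ_eval, ascPochhammer_eval_succ_left]; field_simp
    simp only [ordinaryHypergeometricCoefficient, h5, smul_eq_mul]
    field_simp

/-- Iterating `IsGaussContinuation.raise`, starting from parameters `1 / 2` and `1`. -/
noncomputable def raiseIter (F : ℝ → ℝ) : ℕ → ℝ → ℝ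
  | 0 => F
  | k + 1 => fun z => raiseIter F k z + z / ((k : ℝ) / 2 + 1 / 2) * deriv (raiseIter F k) z

theorem IsGaussContinuation.raiseIter {c : ℝ} (hc : 0 < c) {F : ℝ → ℝ}
    (hF : IsGaussContinuation (1 / 2) 1 c F) (k : ℕ) :
    IsGaussContinuation ((k : ℝ) / 2 + 1 / 2) ((k : ℝ) / 2 + 1) c (raiseIter F k) := by
  induction k with
  | zero => simpa [_root_.raiseIter] using hF
  | succ k ih =>
    -- The swap of parameters in `raise` makes one step advance both by 1/2.
    have h := ih.raise (by positivity) (by positivity) hc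
    have e1 : ((k + 1 : ℕ) : ℝ) / 2 + 1 / 2 = (k : ℝ) / 2 + 1 := by push_cast; ring
    have e2 : ((k + 1 : ℕ) : ℝ) / 2 + 1 = (k : ℝ) / 2 + 1 / 2 + 1 := by push_cast; ring
    rw [e1, e2]
    exact h

theorem IsGaussContinuation.gaussF_eq {a b c : ℝ} {F : ℝ → ℝ}
    (hF : IsGaussContinuation a b c F) {z : ℝ} (hz : z < 1) : gaussF a b c z = F z := by
  unfold gaussF
  split_ifs with h
  · exact (hF.2 z (abs_lt.2 ⟨h, hz⟩)).symm
  · exact (Classical.epsilon_spec (p := IsGaussContinuation a b c) ⟨F, hF⟩).eqOn hF hz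

/-! ### Taylor series of the closed form, and limits at the endpoint. -/

/-- The closed form as a function of `y = 1 - X`. -/
noncomputable def scaledGauss (F : ℝ → ℝ) (x y : ℝ) : ℝ := (1 - y)⁻¹ * F (x / (1 - y) ^ 2)

theorem analyticAt_scaledGauss {F : ℝ → ℝ} (hF : AnalyticOnNhd ℝ F (Set.Iio 1)) {x y : ℝ}
    (hy : y < 1) (hxy : x / (1 - y) ^ 2 < 1) : AnalyticAt ℝ (scaledGauss F x) y := by
  have h1 : (1 : ℝ) - y ≠ 0 := by linarith
  have h2 : ((1 : ℝ) - y) ^ 2 ≠ 0 := pow_ne_zero _ h1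
  have h4 : AnalyticAt ℝ (fun y : ℝ => x / (1 - y) ^ 2) y := by fun_prop (disch := assumption)
  have h5 : AnalyticAt ℝ (fun y : ℝ => (1 - y)⁻¹) y := by fun_prop (disch := assumption)
  exact h5.mul (AnalyticAt.fun_comp_of_eq (hF _ hxy) h4 rfl)

/-- With u = x/(1-y)², the derivative of (1-y)^(-k-1) g(u) is (k+1)(1-y)^(-k-2) (g(u) + u
g'(u)/((k+1)/2)), which is the recursion of `raiseIter`. -/
theorem iteratedDeriv_scaledGauss {F : ℝ → ℝ}
    (hF : ∀ k, AnalyticOnNhd ℝ (raiseIter F k) (Set.Iio 1))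
    (x : ℝ) (k : ℕ) : ∀ y, y < 1 → x / (1 - y) ^ 2 < 1 →
      iteratedDeriv k (scaledGauss F x) y =
        k.factorial * (((1 - y) ^ (k + 1))⁻¹ * raiseIter F k (x / (1 - y) ^ 2)) := by
  induction k with
  | zero => intro y _ _; simp [scaledGauss, raiseIter]
  | succ k ih =>
    intro y hy hxy
    have h1 : (1 : ℝ) - y ≠ 0 := by linarith
    have h2 : ((1 : ℝ) - y) ^ 2 ≠ 0 := pow_ne_zero _ h1
    have hcont : ContinuousAt (fun y : ℝ => x / (1 - y) ^ 2) y := by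
      fun_prop (disch := assumption)
    rw [iteratedDeriv_succ]
    have hev : iteratedDeriv k (scaledGauss F x) =ᶠ[𝓝 y] fun y =>
        k.factorial * (((1 - y) ^ (k + 1))⁻¹ * raiseIter F k (x / (1 - y) ^ 2)) := by
      filter_upwards [Iio_mem_nhds hy, hcont.eventually (Iio_mem_nhds hxy)] with w hw hw'
      exact ih w hw hw'
    rw [hev.deriv_eq]
    have hsub : HasDerivAt (fun y : ℝ => 1 - y) (-1) y := by
      simpa using (hasDerivAt_id y).const_sub 1
    have hinv := (hsub.pow (k + 1)).inv (pow_ne_zero _ h1)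
    have harg := (hasDerivAt_const y x).div (hsub.pow 2) h2
    have hcomp := HasDerivAt.comp (h₂ := raiseIter F k) y
      ((hF k _ hxy).differentiableAt.hasDerivAt) harg
    have := ((hinv.mul hcomp).const_mul (k.factorial : ℝ)).deriv
    refine Eq.trans this ?_
    simp only [Function.comp, Pi.pow_apply, Pi.inv_apply, Pi.div_apply, raiseIter,
      Nat.factorial_succ]
    push_cast
    have hk : (k : ℝ) / 2 + 1 / 2 ≠ 0 := by positivity
    have hk' : (k : ℝ) + 1 ≠ 0 := by positivity
    generalize raiseIter F k = g
    field_simp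
    ring

theorem tendsto_tsum_mul_pow {ι : Type*} {l : Filter ι} {u : ℕ → ℝ} {z : ι → ℝ} {z₀ : ℝ}
    (hs : Summable fun n => |u n| * z₀ ^ n) (hz : Tendsto z l (𝓝 z₀))
    (hz' : ∀ᶠ i in l, 0 ≤ z i ∧ z i ≤ z₀) :
    Tendsto (fun i => ∑' n, u n * z i ^ n) l (𝓝 (∑' n, u n * z₀ ^ n)) := by
  refine tendsto_tsum_of_dominated_convergence hs (fun n => (hz.pow n).const_mul _) ?_
  filter_upwards [hz'] with i hi n
  rw [norm_mul, norm_pow, Real.norm_eq_abs, Real.norm_eq_abs, abs_of_nonneg hi.1]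
  gcongr
  exacts [hi.1, hi.2]

/-- A converse of Abel's theorem for nonnegative coefficients. -/
theorem summable_of_tendsto_tsum_mul_pow {ι : Type*} {l : Filter ι} [l.NeBot] {u : ℕ → ℝ}
    (hu : ∀ n, 0 ≤ u n) {z : ι → ℝ} {L : ℝ} (hz : Tendsto z l (𝓝 1))
    (hz' : ∀ᶠ i in l, 0 ≤ z i ∧ z i ≤ 1) (hs : ∀ᶠ i in l, Summable fun n => u n * z i ^ n)
    (hL : Tendsto (fun i => ∑' n, u n * z i ^ n) l (𝓝 L)) :
    Summable u ∧ ∑' n, u n = L := by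
  have hsum : Summable u := by
    refine summable_of_sum_range_le hu (c := L) fun N => ?_
    have h1 : Tendsto (fun i => ∑ n ∈ Finset.range N, u n * z i ^ n) l
        (𝓝 (∑ n ∈ Finset.range N, u n * 1 ^ n)) :=
      tendsto_finsetSum _ fun n _ => (hz.pow n).const_mul _
    simp only [one_pow, mul_one] at h1
    refine le_of_tendsto_of_tendsto h1 hL ?_
    filter_upwards [hz', hs] with i hi hsi
    exact hsi.sum_le_tsum _ fun n _ => mul_nonneg (hu n) (pow_nonneg hi.1 n)
  have h := tendsto_tsum_mul_pow (u := u) (z₀ := 1) (by simpa using hsum.abs) hz hz'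
  exact ⟨hsum, by simpa using tendsto_nhds_unique h hL⟩

/-- Only a left limit is claimed, since y₀ may be singular: x/(1-y₀)² = 1 or y₀ = 1. -/
theorem tendsto_scaledGauss {F : ℝ → ℝ} (hF : ∀ k, AnalyticOnNhd ℝ (raiseIter F k) (Set.Iio 1))
    {x y₀ : ℝ} (hy₀ : 0 < y₀) (hreg : ∀ y < y₀, y < 1 ∧ x / (1 - y) ^ 2 < 1)
    (hs : Summable fun k => |raiseIter F k x| * y₀ ^ k) :
    Tendsto (scaledGauss F x) (𝓝[<] y₀) (𝓝 (∑' k, raiseIter F k x * y₀ ^ k)) := by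
  set u : ℕ → ℝ := fun k => raiseIter F k x
  have hrad : ENNReal.ofReal y₀ ≤ (FormalMultilinearSeries.ofScalars ℝ u).radius := by
    have := (FormalMultilinearSeries.ofScalars ℝ u).le_radius_of_summable (r := y₀.toNNReal)
      (by simpa [FormalMultilinearSeries.ofScalars_norm, Real.coe_toNNReal _ hy₀.le] using hs)
    exact this
  have hG := hasFPowerSeriesOnBall_tsum (ENNReal.ofReal_pos.2 hy₀) hrad
  have hg : AnalyticOnNhd ℝ (scaledGauss F x) (Set.Ioo (-y₀) y₀) := fun y hy =>
    analyticAt_scaledGauss (hF 0) (hreg y hy.2).1 (hreg y hy.2).2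
  have hmem : (0 : ℝ) ∈ Set.Ioo (-y₀) y₀ := ⟨by linarith, hy₀⟩
  have hEq : Set.EqOn (scaledGauss F x) (fun y => ∑' k, u k * y ^ k) (Set.Ioo (-y₀) y₀) := by
    refine hg.eqOn_of_preconnected_of_eventuallyEq (hG.analyticOnNhd.mono fun y hy => ?_)
      isPreconnected_Ioo hmem ?_
    · rw [Metric.eball_ofReal]
      simpa using abs_lt.2 hy
    · have hT := (hg 0 hmem).hasFPowerSeriesAt
      have hcoef : (fun n => iteratedDeriv n (scaledGauss F x) 0 / (n.factorial : ℝ)) = u := by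
        ext n
        have : (n.factorial : ℝ) ≠ 0 := by positivity
        rw [iteratedDeriv_scaledGauss hF x n 0 one_pos (hreg 0 hy₀).2]
        simp [u]
        field_simp
      rw [hcoef] at hT
      filter_upwards [hT.eventually_hasSum] with y hy
      rw [zero_add] at hy
      rw [← hy.tsum_eq]
      exact tsum_congr fun n => FormalMultilinearSeries.ofScalars_apply_eq _ _ _
  have hlim := tendsto_tsum_mul_pow (l := 𝓝[<] y₀) (z := fun y => y) hs
    (tendsto_id.mono_left nhdsWithin_le_nhds) (by
      filter_upwards [Ioo_mem_nhdsLT hy₀] with y hy using ⟨hy.1.le, hy.2.le⟩)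
  refine hlim.congr' ?_
  filter_upwards [Ioo_mem_nhdsLT (show -y₀ < y₀ by linarith)] with y hy
  exact (hEq hy).symm

theorem gaussCoefficient_nonneg {a b c : ℝ} (ha : 0 < a) (hb : 0 < b) (hc : 0 < c) (n : ℕ) :
    0 ≤ ordinaryHypergeometricCoefficient a b c n := by
  have h1 := ascPochhammer_pos n a ha
  have h2 := ascPochhammer_pos n b hb
  have h3 := ascPochhammer_pos n c hc
  positivity

/-- At an endpoint `y₀` with `x = (1 - y₀) ^ 2` the Gauss series converges at `1`. -/
theorem summable_gauss_of_tendsto_scaledGauss {a b c : ℝ} (ha : 0 < a) (hb : 0 < b) (hc : 0 < c)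
    {F : ℝ → ℝ} (hF : IsGaussContinuation a b c F) {x y₀ S : ℝ} (hy₀ : y₀ < 1)
    (hx : x = (1 - y₀) ^ 2) (h : Tendsto (scaledGauss F x) (𝓝[<] y₀) (𝓝 S)) :
    Summable (ordinaryHypergeometricCoefficient a b c) ∧
      S = (1 - y₀)⁻¹ * ₂F₁ a b c (1 : ℝ) := by
  have h0 : (1 : ℝ) - y₀ ≠ 0 := by linarith
  have hz : Tendsto (fun y : ℝ => x / (1 - y) ^ 2) (𝓝[<] y₀) (𝓝 1) := by
    have : ((1 : ℝ) - y₀) ^ 2 ≠ 0 := pow_ne_zero _ h0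
    have hc : ContinuousAt (fun y : ℝ => x / (1 - y) ^ 2) y₀ := by
      fun_prop (disch := assumption)
    have h1 : x / (1 - y₀) ^ 2 = 1 := by rw [hx, div_self this]
    simpa [h1] using hc.tendsto.mono_left nhdsWithin_le_nhds
  have hlt : ∀ᶠ y in 𝓝[<] y₀, 0 ≤ x / (1 - y) ^ 2 ∧ x / (1 - y) ^ 2 < 1 := by
    filter_upwards [self_mem_nhdsWithin] with y hy
    have hy : y < y₀ := hy
    refine ⟨by rw [hx]; positivity, ?_⟩
    rw [div_lt_one (by nlinarith), hx]
    nlinarith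
  have hlt' : ∀ᶠ y in 𝓝[<] y₀, |x / (1 - y) ^ 2| < 1 := hlt.mono fun y hy => by
    rw [abs_of_nonneg hy.1]; exact hy.2
  have hL : Tendsto (fun y => ∑' n, ordinaryHypergeometricCoefficient a b c n *
      (x / (1 - y) ^ 2) ^ n) (𝓝[<] y₀) (𝓝 ((1 - y₀) * S)) := by
    have h1 : Tendsto (fun y : ℝ => 1 - y) (𝓝[<] y₀) (𝓝 (1 - y₀)) :=
      (tendsto_const_nhds.sub tendsto_id).mono_left nhdsWithin_le_nhds
    refine (h1.mul h).congr' ?_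
    filter_upwards [hlt', self_mem_nhdsWithin] with y hy hy'
    have hy' : y < y₀ := hy'
    have : (1 : ℝ) - y ≠ 0 := by linarith
    rw [scaledGauss, mul_inv_cancel_left₀ this, hF.2 _ hy, gauss_eq_tsum]
  obtain ⟨h1, h2⟩ := summable_of_tendsto_tsum_mul_pow (gaussCoefficient_nonneg ha hb hc) hz
    (hlt.mono fun y hy => ⟨hy.1, hy.2.le⟩) (hlt'.mono fun y hy => by
      have h := ((hasFPowerSeriesOnBall_gauss ha hb hc).hasSum (mem_eball_zero_one hy)).summable
      simp only [FormalMultilinearSeries.ofScalars_apply_eq, smul_eq_mul] at h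
      exact h) hL
  refine ⟨h1, ?_⟩
  rw [gauss_eq_tsum]
  simp only [one_pow, mul_one, h2]
  rw [inv_mul_cancel_left₀ h0]

/-! ### The range of x, and the exceptional case X = 0. -/

theorem le_hypX_sq {η x : ℝ} (hη : 0 < η)
    (hx : (1 ≤ η ∧ x ∈ Set.Icc (-1 : ℝ) 1) ∨ (η < 1 ∧ x ∈ Set.Ioc (-η) (η ^ 2))) :
    x ≤ hypX η x ^ 2 := by
  have h : hypX η x ^ 2 - x = (1 - x) * (η ^ 2 - x) / (1 + η) ^ 2 := by
    unfold hypX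
    field_simp
    ring
  have h2 : 0 ≤ (1 - x) * (η ^ 2 - x) := by
    rcases hx with ⟨h1, h2, h3⟩ | ⟨h1, h2, h3⟩ <;> apply mul_nonneg <;> nlinarith
  have : 0 ≤ (1 - x) * (η ^ 2 - x) / (1 + η) ^ 2 := by positivity
  linarith

theorem hypX_nonneg {η x : ℝ} (hη : 0 < η)
    (hx : (1 ≤ η ∧ x ∈ Set.Icc (-1 : ℝ) 1) ∨ (η < 1 ∧ x ∈ Set.Ioc (-η) (η ^ 2))) :
    0 ≤ hypX η x := by
  refine div_nonneg ?_ (by linarith)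
  rcases hx with ⟨h1, h2, h3⟩ | ⟨h1, h2, h3⟩ <;> linarith

theorem eq_one_and_eq_neg_one_of_hypX_eq_zero {η x : ℝ} (hη : 0 < η)
    (hx : (1 ≤ η ∧ x ∈ Set.Icc (-1 : ℝ) 1) ∨ (η < 1 ∧ x ∈ Set.Ioc (-η) (η ^ 2)))
    (h : hypX η x = 0) : η = 1 ∧ x = -1 := by
  have h' : x + η = 0 := by
    rcases div_eq_zero_iff.1 h with h | h
    · exact h
    · linarith
  rcases hx with ⟨h1, h2, h3⟩ | ⟨h1, h2, h3⟩
  · constructor <;> linarith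
  · linarith

theorem hypClosedForm_eq_scaledGauss {η c x : ℝ} {F : ℝ → ℝ}
    (hF : IsGaussContinuation (1 / 2) 1 c F) (h : x / hypX η x ^ 2 < 1) :
    hypClosedForm η c x = scaledGauss F x (1 - hypX η x) := by
  rw [hypClosedForm, scaledGauss, hF.gaussF_eq h, sub_sub_cancel, one_div]

/-- Homogeneity lets x be frozen at -1 while the movement is transferred to y. -/
theorem scaledGauss_neg {F : ℝ → ℝ} {t : ℝ} (ht : 0 < t) (X : ℝ) :
    scaledGauss F (-t) (1 - X) = (√t)⁻¹ * scaledGauss F (-1) (1 - X / √t) := by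
  have h := Real.sqrt_pos.2 ht
  have h2 : √t ^ 2 = t := Real.sq_sqrt ht.le
  simp only [scaledGauss, sub_sub_cancel, div_pow, h2]
  rw [← mul_assoc, ← mul_inv, mul_div_cancel₀ _ h.ne', div_div_eq_mul_div, neg_one_mul]

/-- Along `x ↓ -1` with `η = 1`, the closed form has the limit of `scaledGauss F (-1)` at `1`. -/
theorem tendsto_hypClosedForm_neg_one {c S : ℝ} {F : ℝ → ℝ}
    (hF : IsGaussContinuation (1 / 2) 1 c F)
    (h : Tendsto (scaledGauss F (-1)) (𝓝[<] 1) (𝓝 S)) :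
    Tendsto (fun t : ℝ => hypClosedForm 1 c t) (𝓝[>] (-1)) (𝓝 S) := by
  have hsq : ContinuousAt (fun t : ℝ => √(-t)) (-1) := by fun_prop
  have hsqrt : Tendsto (fun t : ℝ => √(-t)) (𝓝[>] (-1)) (𝓝 1) := by
    simpa using hsq.tendsto.mono_left nhdsWithin_le_nhds
  have hX : Tendsto (fun t : ℝ => hypX 1 t) (𝓝[>] (-1)) (𝓝 0) := by
    have : ContinuousAt (fun t : ℝ => hypX 1 t) (-1) := by unfold hypX; fun_prop
    simpa [hypX] using this.tendsto.mono_left nhdsWithin_le_nhds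
  have harg : Tendsto (fun t : ℝ => 1 - hypX 1 t / √(-t)) (𝓝[>] (-1)) (𝓝[<] 1) := by
    refine tendsto_nhdsWithin_iff.2 ⟨?_, ?_⟩
    · simpa using tendsto_const_nhds.sub (hX.div hsqrt one_ne_zero)
    · filter_upwards [Ioo_mem_nhdsGT (show (-1 : ℝ) < 0 by norm_num)] with t ht
      have h1 : 0 < √(-t) := Real.sqrt_pos.2 (by linarith [ht.2])
      have h2 : 0 < hypX 1 t := div_pos (by linarith [ht.1]) (by norm_num)
      have := div_pos h2 h1
      exact sub_lt_self 1 this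
  have hlim := (hsqrt.inv₀ one_ne_zero).mul (h.comp harg)
  rw [inv_one, one_mul] at hlim
  refine hlim.congr' ?_
  filter_upwards [Ioo_mem_nhdsGT (show (-1 : ℝ) < 0 by norm_num)] with t ht
  have hlt : t / hypX 1 t ^ 2 < 1 :=
    (div_nonpos_of_nonpos_of_nonneg ht.2.le (sq_nonneg _)).trans_lt one_pos
  rw [hypClosedForm_eq_scaledGauss hF hlt]
  have := scaledGauss_neg (F := F) (show 0 < -t by linarith [ht.2]) (hypX 1 t)
  rw [neg_neg] at this
  exact this.symm

theorem tendsto_scaledGauss_hypSum {c η x : ℝ} (hc : 0 < c) (hη : 0 < η)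
    (hx : (1 ≤ η ∧ x ∈ Set.Icc (-1 : ℝ) 1) ∨ (η < 1 ∧ x ∈ Set.Ioc (-η) (η ^ 2)))
    (hx1 : x < 1) {F : ℝ → ℝ} (hF : IsGaussContinuation (1 / 2) 1 c F)
    (hS : Summable fun k : ℕ => |hypSumTerm η c x k|) :
    Tendsto (scaledGauss F x) (𝓝[<] (1 - hypX η x)) (𝓝 (hypSum η c x)) := by
  have hy : 1 - hypX η x = (1 - x) / (1 + η) := by unfold hypX; field_simp; ring
  have hy₀ : 0 < 1 - hypX η x := by rw [hy]; exact div_pos (by linarith) (by linarith)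
  have hterm : ∀ k, hypSumTerm η c x k = raiseIter F k x * (1 - hypX η x) ^ k := fun k => by
    rw [hypSumTerm, (hF.raiseIter hc k).gaussF_eq hx1, hy, mul_comm]
  have hX := hypX_nonneg hη hx
  have hXx := le_hypX_sq hη hx
  simp only [hypSum, hterm]
  refine tendsto_scaledGauss (fun k => (hF.raiseIter hc k).1) hy₀ (fun y hy => ?_) ?_
  · have h1 : hypX η x < 1 - y := by linarith
    refine ⟨by linarith, ?_⟩
    rw [div_lt_one (by nlinarith)]
    nlinarith
  · refine hS.congr fun k => ?_
    rw [hterm, abs_mul, abs_pow, abs_of_pos hy₀]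

theorem theorem1 (c η x : ℝ) (hc : 0 < c) (hη : 0 < η)
    (hx : (1 ≤ η ∧ x ∈ Set.Icc (-1 : ℝ) 1) ∨ (η < 1 ∧ x ∈ Set.Ioc (-η) (η ^ 2)))
    (hS : HypSumConvergesAbsolutely η c x) :
    (hypX η x ≠ 0 →
      GaussDefined (1 / 2) 1 c (x / hypX η x ^ 2) ∧
        hypSum η c x = hypClosedForm η c x) ∧
    (hypX η x = 0 →
      Tendsto (fun t : ℝ => hypClosedForm η c t) (𝓝[>] x) (𝓝 (hypSum η c x))) := by
  obtain ⟨F, hF⟩ := exists_isGaussContinuation_one (a := 1 / 2) (by norm_num) (by norm_num) hc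
  have hle1 : x ≤ 1 := by
    rcases hx with ⟨h1, h2, h3⟩ | ⟨h1, h2, h3⟩
    · exact h3
    · nlinarith
  rcases hle1.eq_or_lt with rfl | hx1
  -- For x = 1 the point y₀ is 0, so no left-limit argument is needed: only the term k = 0 survives.
  · have hX : hypX η 1 = 1 := by unfold hypX; rw [add_comm]; exact div_self (by linarith)
    refine ⟨fun _ => ⟨Or.inr ⟨by rw [hX]; norm_num, hS.1 rfl⟩, ?_⟩, fun h => by simp [hX] at h⟩
    rw [hypSum, tsum_eq_single 0 fun k hk => by simp [hypSumTerm, hk]]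
    simp [hypSumTerm, hypClosedForm, hX]
  have hlim := tendsto_scaledGauss_hypSum hc hη hx hx1 hF hS.2
  have hXx := le_hypX_sq hη hx
  refine ⟨fun hX0 => ?_, fun hX0 => ?_⟩
  · have hX : 0 < hypX η x := (hypX_nonneg hη hx).lt_of_ne' hX0
    have hX2 : 0 < hypX η x ^ 2 := by positivity
    rcases hXx.eq_or_lt with heq | hlt
    · have hz : x / hypX η x ^ 2 = 1 := by rw [← heq]; exact div_self (by linarith)
      obtain ⟨h1, h2⟩ := summable_gauss_of_tendsto_scaledGauss (by norm_num) one_pos hc hF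
        (by linarith) (by rwa [sub_sub_cancel]) hlim
      refine ⟨Or.inr ⟨hz, h1⟩, ?_⟩
      rw [h2, hypClosedForm, hz, sub_sub_cancel, ← one_div, gaussF, if_pos (by norm_num)]
    · have hz : x / hypX η x ^ 2 < 1 := (div_lt_one hX2).2 hlt
      refine ⟨Or.inl ⟨hz, F, hF⟩, ?_⟩
      rw [hypClosedForm_eq_scaledGauss hF hz]
      refine tendsto_nhds_unique hlim ?_
      exact (analyticAt_scaledGauss hF.1 (by linarith)
        (by rwa [sub_sub_cancel])).continuousAt.tendsto.mono_left nhdsWithin_le_nhds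
  · obtain ⟨rfl, rfl⟩ := eq_one_and_eq_neg_one_of_hypX_eq_zero hη hx hX0
    rw [hX0, sub_zero] at hlim
    exact tendsto_hypClosedForm_neg_one hF hlim
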